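/- For a graph $H$ and a natural number $n$, let $\mathrm{ex}(n,H)$ denote the largest number of edges in a simple graph on $n$ vertices containing no (not necessarily induced) subgraph isomorphic to $H$. The subdivision of a graph is obtained by replacing each of its edges with a path of length two, these paths being internally disjoint. For all integers $s$ and $t$ with $2 \le s \le t$, there exists a constant $C$, depending only on $s$ and $t$, such that if $H_{s,t}$ is the subdivision of the complete bipartite graph $K_{s,t}$, then for every natural number $n$, $$\mathrm{ex}(n, H_{s,t}) \le C\, n^{\frac32 - \frac{1}{12t}}.$$ -/

import Mathlib

/-- The (1-)subdivision of a simple graph `G`: every edge of `G` is replaced by a path of length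
two, the paths being internally disjoint. Its vertices are the vertices of `G` together with one
new vertex for each edge `e` of `G`, and the new vertex `e` is adjacent exactly to the two
endpoints of `e`. -/
def SimpleGraph.subdivision {V : Type*} (G : SimpleGraph V) : SimpleGraph (V ⊕ G.edgeSet) where
  Adj
    | Sum.inl v, Sum.inr e => v ∈ (e : Sym2 V)
    | Sum.inr e, Sum.inl v => v ∈ (e : Sym2 V)
    | Sum.inl _, Sum.inl _ => False
    | Sum.inr _, Sum.inr _ => False
  symm := ⟨by
    rintro (u | e) (v | f) h
    · exact h
    · exact h
    · exact h
    · exact h⟩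
  loopless := ⟨by
    rintro (u | e) h
    · exact h
    · exact h⟩

theorem SimpleGraph.subdivision_adj_inl_inr {V : Type*} (G : SimpleGraph V) (v : V)
    (e : G.edgeSet) : G.subdivision.Adj (Sum.inl v) (Sum.inr e) ↔ v ∈ (e : Sym2 V) :=
  Iff.rfl

/-- `H_{s,t}`, the subdivision of the complete bipartite graph `K_{s,t}`. -/
def subdividedCompleteBipartite (s t : ℕ) :
    SimpleGraph ((Fin s ⊕ Fin t) ⊕ (completeBipartiteGraph (Fin s) (Fin t)).edgeSet) :=
  (completeBipartiteGraph (Fin s) (Fin t)).subdivision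

/-! Trim the graph to a bipartite relation between `A` and `B`, with degrees at least `δ` from `A`
and at most `D` from `B`. If some `s + t` vertices of `A` pairwise have at least `s * t` common
neighbours, they are the branch vertices of a copy. Otherwise any `s + t` of them contain a pair of
smaller codegree. Turán's theorem inside the neighbourhood of each `b ∈ B` then yields, in every
large subset of `A`, a vertex with many light neighbours, whose codegree with it is positive but
small (`exists_le_card_lightNeighbors`).

So a clique of light pairs can be grown greedily. As light codegrees are bounded, few vertices have
to be discarded to keep any three clique vertices from sharing a neighbour
(`exists_isLightClique_insert`). Distinct edges of `K_{s,t}` then have disjoint nonempty sets of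
candidate subdivision vertices.

Each of the `k = s + t - 1 ≤ 2t - 1` steps keeps a proportion `Q` of the candidates. With degrees at
least `Y`, about `n^(1/2 - 1/(8t))`, `Q` is about `n^(-1/(4t))`, so `Q^k * Y` still beats the
logarithms lost in trimming. -/

/-! ### Turán, max-cut and level-set estimates -/

section SparsePairs

open Finset
open scoped Classical

/-- **Turán's theorem** for a relation: if every `k + 1` elements of `M` contain a related pair,
then `M` has many related pairs. -/
theorem sq_card_le_of_forall_card_eq_exists {α : Type*} (P : α → α → Prop)
    (hP : ∀ x y, P x y → P y x) (M : Finset α) (k : ℕ) (hk : 0 < k)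
    (h : ∀ S ⊆ M, #S = k + 1 → ∃ x ∈ S, ∃ y ∈ S, x ≠ y ∧ P x y) :
    #M ^ 2 ≤ k * (#{p ∈ M ×ˢ M | p.1 ≠ p.2 ∧ P p.1 p.2} + #M) := by
  -- Edges are the unrelated pairs, so the hypothesis forbids cliques of size `k + 1`.
  let G : SimpleGraph M :=
    { Adj := fun x y => x ≠ y ∧ ¬ P x y
      symm := ⟨fun x y hxy => ⟨hxy.1.symm, fun h' => hxy.2 (hP _ _ h')⟩⟩
      loopless := ⟨fun x hx => hx.1 rfl⟩ }
  have hfree : G.CliqueFree (k + 1) := by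
    intro S hS
    obtain ⟨x, hx, y, hy, hxy, hPxy⟩ := h (S.map (Function.Embedding.subtype _))
      (by intro x hx; simp only [mem_map] at hx; obtain ⟨y, -, rfl⟩ := hx; exact y.2)
      (by rw [card_map]; exact hS.2)
    simp only [mem_map, Function.Embedding.subtype_apply] at hx hy
    obtain ⟨x, hx, rfl⟩ := hx
    obtain ⟨y, hy, rfl⟩ := hy
    have := hS.1 (mem_coe.2 hx) (mem_coe.2 hy) (fun h => hxy (by rw [h]))
    exact this.2 hPxy
  have hT := hfree.card_edgeFinset_le
  have hT2 : 2 * k * #G.edgeFinset ≤ (k - 1) * #M ^ 2 := by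
    have h1 := (SimpleGraph.isTuranMaximal_turanGraph (n := #M) hk)
    have h2 := SimpleGraph.mul_card_edgeFinset_turanGraph_le (n := #M) (r := k)
    have h3 : #G.edgeFinset ≤ #(SimpleGraph.turanGraph #M k).edgeFinset := by
      rw [SimpleGraph.card_edgeFinset_turanGraph]; simpa using hT
    calc _ ≤ 2 * k * #(SimpleGraph.turanGraph #M k).edgeFinset := by gcongr
      _ ≤ _ := h2
  have hdeg : ∀ x : M, G.degree x + #{y ∈ M | x.1 ≠ y ∧ P x y} + 1 = #M := by
    intro x
    have e1 : G.degree x = #{y ∈ M | x.1 ≠ y ∧ ¬ P x y} := by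
      rw [← SimpleGraph.card_neighborFinset_eq_degree,
        ← card_map (Function.Embedding.subtype (· ∈ M))]
      congr 1
      ext y
      simp only [mem_map, SimpleGraph.mem_neighborFinset, Function.Embedding.subtype_apply,
        mem_filter, G]
      constructor
      · rintro ⟨y, h1, rfl⟩
        exact ⟨y.2, fun h => h1.1 (Subtype.ext h), h1.2⟩
      · rintro ⟨hy, h1, h2⟩
        exact ⟨⟨y, hy⟩, ⟨fun h => h1 (by rw [h]), h2⟩, rfl⟩
    have e2 : #{y ∈ M | x.1 = y} = 1 := by
      rw [card_eq_one]; exact ⟨x, by ext y; simp only [mem_filter, mem_singleton]; grind⟩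
    have e3 := card_filter_add_card_filter_not (s := {y ∈ M | x.1 ≠ y}) (fun y => P x y)
    have e4 := card_filter_add_card_filter_not (s := M) (fun y => x.1 = y)
    rw [filter_filter, filter_filter] at e3
    simp only [ne_eq] at *
    omega
  have hsum := G.sum_degrees_eq_twice_card_edges
  have hpairs : #{p ∈ M ×ˢ M | p.1 ≠ p.2 ∧ P p.1 p.2} =
      ∑ x : M, #{y ∈ M | x.1 ≠ y ∧ P x y} := by
    rw [card_filter, sum_product, ← sum_coe_sort M]
    simp only [card_filter]
  have htot : ∑ x : M, (G.degree x + #{y ∈ M | x.1 ≠ y ∧ P x y} + 1) = #M * #M := by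
    simp only [hdeg]; simp
  simp only [sum_add_distrib] at htot
  rw [hsum, ← hpairs] at htot
  simp only [sum_const, card_univ, Fintype.card_coe, smul_eq_mul, mul_one] at htot
  obtain ⟨j, rfl⟩ : ∃ j, k = j + 1 := ⟨k - 1, by omega⟩
  simp only [Nat.add_sub_cancel] at hT2
  nlinarith

/-- Every weighted graph has a cut carrying at least half of its weight. -/
theorem exists_cut_of_symmetric {α : Type*} (c : α → α → ℕ) (hc : ∀ x y, c x y = c y x)
    (hc0 : ∀ x, c x x = 0) (W : Finset α) :
    ∃ X ⊆ W, ∑ a ∈ W, ∑ b ∈ W, c a b ≤ 4 * ∑ a ∈ X, ∑ b ∈ W \ X, c a b := by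
  induction W using Finset.induction_on with
  | empty => exact ⟨∅, by simp, by simp⟩
  | insert v W hv ih =>
    obtain ⟨X, hX, hle⟩ := ih
    have hvX : v ∉ X := fun h => hv (hX h)
    have hvW : v ∉ W \ X := fun h => hv (mem_sdiff.1 h).1
    have hL : ∑ a ∈ insert v W, ∑ b ∈ insert v W, c a b
        = 2 * ∑ b ∈ W, c v b + ∑ a ∈ W, ∑ b ∈ W, c a b := by
      simp only [sum_insert hv, sum_add_distrib, hc0]
      simp only [fun a => hc a v]
      ring
    have hsplit : ∑ b ∈ W \ X, c v b + ∑ b ∈ X, c v b = ∑ b ∈ W, c v b := sum_sdiff hX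
    -- Put `v` opposite the side to which it sends more weight.
    rcases le_total (∑ b ∈ W \ X, c v b) (∑ b ∈ X, c v b) with h | h
    · refine ⟨X, hX.trans (subset_insert _ _), ?_⟩
      rw [insert_sdiff_of_notMem _ hvX]
      simp only [sum_insert hvW, sum_add_distrib]
      rw [hL]
      simp only [fun a => hc a v]
      omega
    · refine ⟨insert v X, insert_subset_insert _ hX, ?_⟩
      have : insert v W \ insert v X = W \ X := by
        ext y; simp only [mem_sdiff, mem_insert]; grind
      rw [this, sum_insert hvX, hL]
      omega

/-- Comparison of the `L¹` and weak `L¹` norms of a bounded function with values in `ℕ`. -/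
theorem exists_sum_le_mul_card_filter_mul_harmonic {α : Type*} (S : Finset α) (f : α → ℕ) (n : ℕ)
    (hf : ∀ a ∈ S, f a ≤ n) (hpos : 0 < ∑ a ∈ S, f a) :
    ∃ τ : ℕ, 0 < τ ∧ (∑ a ∈ S, f a : ℕ) ≤ (τ * #{a ∈ S | τ ≤ f a} : ℝ) * (harmonic n : ℝ) := by
  have hn : 0 < n := by
    by_contra h0
    have : ∑ a ∈ S, f a = 0 := sum_eq_zero fun a ha => by have := hf a ha; omega
    omega
  have hH : (harmonic n : ℝ) = ∑ i ∈ range n, ((i : ℝ) + 1)⁻¹ := by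
    simp [harmonic]
  have hHpos : (0 : ℝ) < harmonic n := by exact_mod_cast harmonic_pos hn.ne'
  -- Layer-cake formula: if every level `τ` failed, summing the bounds proportional to `1 / τ` would
  -- give less than the total.
  have hsum : ∑ a ∈ S, f a = ∑ i ∈ range n, #{a ∈ S | i + 1 ≤ f a} := by
    simp only [card_filter]
    rw [sum_comm]
    refine sum_congr rfl fun a ha => ?_
    rw [← card_filter]
    have : {i ∈ range n | i + 1 ≤ f a} = range (f a) := by
      ext i; have := hf a ha; simp only [mem_filter, mem_range]; omega
    rw [this, card_range]
  by_contra! hcon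
  have hlt : ∑ i ∈ range n, (#{a ∈ S | i + 1 ≤ f a} : ℝ)
      < ∑ i ∈ range n, ((i : ℝ) + 1)⁻¹ * ((∑ a ∈ S, f a : ℕ) / (harmonic n : ℝ)) := by
    refine sum_lt_sum_of_nonempty (by simpa using hn.ne') fun i _ => ?_
    have := hcon (i + 1) (by omega)
    rw [← div_eq_inv_mul, lt_div_iff₀ (by positivity), lt_div_iff₀ hHpos]
    push_cast at this ⊢
    linarith
  rw [← sum_mul, ← hH, mul_div_cancel₀ _ hHpos.ne'] at hlt
  rw [hsum] at hlt
  push_cast at hlt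
  exact lt_irrefl _ hlt

end SparsePairs

/-! ### Light pairs and greedy growth of light cliques -/

section LightCliques

open Finset
open scoped Classical

variable {α β : Type*}

/-- The number of common neighbours of `x` and `y` in `B`. -/
noncomputable def codegree (r : α → β → Prop) (B : Finset β) (x y : α) : ℕ :=
  #{b ∈ B | r x b ∧ r y b}

theorem codegree_comm (r : α → β → Prop) (B : Finset β) (x y : α) :
    codegree r B x y = codegree r B y x := by
  simp only [codegree, and_comm]

/-- The elements of `U` that have at least one, but fewer than `m`, common neighbours with `u`. -/
noncomputable def lightNeighbors (r : α → β → Prop) (B : Finset β) (m : ℕ) (U : Finset α) (u : α) :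
    Finset α :=
  {v ∈ U | u ≠ v ∧ 0 < codegree r B u v ∧ codegree r B u v < m}

/-- In a set all of whose `k + 1`-element subsets contain a pair of small codegree, some element
has many light neighbours. -/
theorem exists_le_card_lightNeighbors (r : α → β → Prop) (B : Finset β) (U : Finset α)
    (k m δ : ℕ) (hk : 0 < k) (hU : U.Nonempty)
    (hδ : ∀ u ∈ U, δ ≤ #{b ∈ B | r u b})
    (hsmall : ∀ S ⊆ U, #S = k + 1 → ∃ x ∈ S, ∃ y ∈ S, x ≠ y ∧ codegree r B x y < m)
    (hlarge : 2 * #B * k ≤ δ * #U) :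
    ∃ u ∈ U, δ ^ 2 * #U ≤ 2 * #B * k * m * #(lightNeighbors r B m U u) := by
  set d : β → ℕ := fun b => #{a ∈ U | r a b} with hd
  set P : ℕ := ∑ b ∈ B, #{p ∈ {a ∈ U | r a b} ×ˢ {a ∈ U | r a b} |
    p.1 ≠ p.2 ∧ codegree r B p.1 p.2 < m} with hPdef
  have hturan : ∑ b ∈ B, d b ^ 2 ≤ k * (P + ∑ b ∈ B, d b) := by
    rw [hPdef, ← sum_add_distrib, mul_sum]
    refine sum_le_sum fun b _ => ?_
    convert! sq_card_le_of_forall_card_eq_exists (fun x y => codegree r B x y < m)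
      (fun x y h => by rwa [codegree_comm]) {a ∈ U | r a b} k hk fun S hS hcard =>
        hsmall S (hS.trans (filter_subset _ _)) hcard
  have hdsum : ∑ b ∈ B, d b = ∑ u ∈ U, #{b ∈ B | r u b} :=
    (sum_card_bipartiteAbove_eq_sum_card_bipartiteBelow r).symm
  have hdlow : δ * #U ≤ ∑ b ∈ B, d b := by
    rw [hdsum, mul_comm]
    simpa using card_nsmul_le_sum U _ δ hδ
  have hcs : (∑ b ∈ B, d b) ^ 2 ≤ #B * ∑ b ∈ B, d b ^ 2 := sq_sum_le_card_mul_sum_sq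
  -- `P` counts each pair of small codegree once per common neighbour: fewer than `m` times, and
  -- never if the codegree is `0`.
  have hPle : P ≤ m * ∑ u ∈ U, #(lightNeighbors r B m U u) := by
    have h1 : P = ∑ p ∈ U ×ˢ U, ∑ b ∈ B,
        if (p.1 ≠ p.2 ∧ codegree r B p.1 p.2 < m) ∧ r p.1 b ∧ r p.2 b then 1 else 0 := by
      rw [sum_comm, hPdef]
      refine sum_congr rfl fun b _ => ?_
      rw [← card_filter]
      congr 1
      ext p
      simp only [mem_filter, mem_product]
      tauto
    rw [h1, sum_product, mul_sum]
    refine sum_le_sum fun u _ => ?_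
    rw [lightNeighbors, card_filter, mul_sum]
    refine sum_le_sum fun v _ => ?_
    dsimp only
    by_cases hc : u ≠ v ∧ codegree r B u v < m
    · have : (∑ b ∈ B, if (u ≠ v ∧ codegree r B u v < m) ∧ r u b ∧ r v b then 1 else 0)
          = codegree r B u v := by
        simp only [hc, true_and, ne_eq, not_false_eq_true]
        rw [codegree, card_filter]
      rw [this]
      split_ifs with h
      · omega
      · by_contra h0
        exact h ⟨hc.1, by omega, hc.2⟩
    · simp [hc]
  have hfinal : (δ * #U) ^ 2 ≤ 2 * #B * k * (m * ∑ u ∈ U, #(lightNeighbors r B m U u)) := by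
    set s := ∑ b ∈ B, d b
    have h1 : s ^ 2 ≤ #B * (k * (P + s)) := hcs.trans (by gcongr)
    -- The diagonal term of Turán's bound is at most half of `s ^ 2`, hence absorbed.
    have h2 : (2 * #B * k) * s ≤ s * s := Nat.mul_le_mul_right _ (hlarge.trans hdlow)
    have h3 : s ^ 2 ≤ 2 * #B * k * P := by nlinarith
    calc (δ * #U) ^ 2 ≤ s ^ 2 := by gcongr
      _ ≤ _ := h3
      _ ≤ _ := by gcongr
  by_contra! hcon
  have hlt := sum_lt_sum_of_nonempty hU hcon
  rw [← mul_sum, sum_const, smul_eq_mul] at hlt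
  nlinarith

/-- A set of vertices all of whose pairs have positive codegree smaller than `m`, and in which no
three vertices have a common neighbour. -/
structure IsLightClique (r : α → β → Prop) (B : Finset β) (m : ℕ) (S : Finset α) : Prop where
  pos : ∀ x ∈ S, ∀ y ∈ S, x ≠ y → 0 < codegree r B x y
  lt : ∀ x ∈ S, ∀ y ∈ S, x ≠ y → codegree r B x y < m
  triple : ∀ x ∈ S, ∀ y ∈ S, ∀ z ∈ S, x ≠ y → x ≠ z → y ≠ z →
    ∀ b ∈ B, r x b → r y b → ¬ r z b

theorem isLightClique_singleton (r : α → β → Prop) (B : Finset β) (m : ℕ) (v : α) :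
    IsLightClique r B m {v} := by
  constructor <;> simp +contextual

theorem IsLightClique.insert_insert {r : α → β → Prop} {B : Finset β} {m : ℕ} {S : Finset α}
    {u v : α} (hu : IsLightClique r B m (insert u S)) (hv : IsLightClique r B m (insert v S))
    (hpos : 0 < codegree r B u v) (hlt : codegree r B u v < m)
    (htriple : ∀ x ∈ S, ∀ b ∈ B, r x b → r u b → ¬ r v b) :
    IsLightClique r B m (insert v (insert u S)) := by
  have hpos' := hpos
  have hlt' := hlt
  rw [codegree_comm] at hpos' hlt'
  obtain ⟨u1, u2, u3⟩ := hu
  obtain ⟨v1, v2, v3⟩ := hv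
  simp only [mem_insert] at *
  constructor <;> simp only [mem_insert]
  · rintro x (rfl | rfl | hx) y (rfl | rfl | hy) hxy <;> grind
  · rintro x (rfl | rfl | hx) y (rfl | rfl | hy) hxy <;> grind
  · rintro x (rfl | rfl | hx) y (rfl | rfl | hy) z (rfl | rfl | hz) hxy hxz hyz b hb h1 h2 h3 <;>
      grind

/-- `U` is a reservoir of vertices each of which extends `S`. Some `u ∈ U` has at least `2 * Q * #U`
light neighbours in `U`; `h2` ensures that deleting those that would create a bad triple costs at
most half of them. -/
theorem exists_isLightClique_insert (r : α → β → Prop) (A : Finset α) (B : Finset β)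
    (k m δ D : ℕ) (Q : ℝ) (hk : 0 < k) (hm : 0 < m) (hB : 0 < #B) (hA : 0 < #A)
    (hδ : ∀ u ∈ A, δ ≤ #{b ∈ B | r u b}) (hD : ∀ b ∈ B, #{a ∈ A | r a b} ≤ D)
    (hsmall : ∀ S ⊆ A, #S = k + 1 → ∃ x ∈ S, ∃ y ∈ S, x ≠ y ∧ codegree r B x y < m)
    (hQ0 : 0 < Q) (hQ1 : Q ≤ 1) (hQ : 4 * #B * k * m * Q ≤ (δ : ℝ) ^ 2)
    (h1 : 2 * #B * k ≤ δ * (Q ^ k * #A)) (h2 : k * m * D ≤ Q ^ k * #A) (i : ℕ) (hi : i ≤ k) :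
    ∃ S U : Finset α, S ⊆ A ∧ U ⊆ A ∧ #S = i ∧ Q ^ i * #A ≤ #U ∧
      ∀ v ∈ U, v ∉ S ∧ IsLightClique r B m (insert v S) := by
  induction i with
  | zero =>
    exact ⟨∅, A, by simp, subset_rfl, by simp, by simp,
      fun v _ => ⟨by simp, by simpa using isLightClique_singleton r B m v⟩⟩
  | succ i ih =>
    obtain ⟨S, U, hSA, hUA, hScard, hUcard, hgood⟩ := ih (by omega)
    have hQk : Q ^ k * #A ≤ #U :=
      le_trans (by gcongr ?_ * _; exact pow_le_pow_of_le_one hQ0.le hQ1 (by omega)) hUcard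
    have hUpos : 0 < #U := by
      have : (0 : ℝ) < #U := lt_of_lt_of_le (by positivity) hQk
      exact_mod_cast this
    have hUlarge : 2 * #B * k ≤ δ * #U := by
      have : (2 * #B * k : ℝ) ≤ δ * #U := h1.trans (by gcongr)
      exact_mod_cast this
    obtain ⟨u, huU, hu⟩ := exists_le_card_lightNeighbors r B U k m δ hk (card_pos.1 hUpos)
      (fun u hu => hδ u (hUA hu)) (fun S hS => hsmall S (hS.trans hUA)) hUlarge
    have hlight : 2 * Q * #U ≤ #(lightNeighbors r B m U u) := by
      have hu' : (δ : ℝ) ^ 2 * #U ≤ 2 * #B * k * m * #(lightNeighbors r B m U u) := by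
        exact_mod_cast hu
      have h3 : 4 * #B * k * m * Q * #U ≤ (δ : ℝ) ^ 2 * #U := by gcongr
      have h4 : (0 : ℝ) < 2 * #B * k * m := by positivity
      refine le_of_mul_le_mul_left ?_ h4
      linarith
    -- The vertices adjacent to a common neighbour of `u` and some `x ∈ S`: at most `k` choices of
    -- `x`, `m` common neighbours, `D` vertices at each.
    set R : Finset α := S.biUnion fun x => ({b ∈ B | r x b ∧ r u b} : Finset β).biUnion
      fun b => {a ∈ A | r a b} with hR
    have hRcard : #R ≤ k * m * D := by
      calc #R ≤ #S * (m * D) := by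
            refine card_biUnion_le_card_mul _ _ _ fun x hx => ?_
            refine (card_biUnion_le_card_mul _ _ D fun b hb => hD b (mem_filter.1 hb).1).trans ?_
            refine Nat.mul_le_mul_right _ ?_
            exact ((hgood u huU).2.lt x (by simp [hx]) u (by simp)
              (fun h => (hgood u huU).1 (h ▸ hx))).le
        _ ≤ k * (m * D) := by gcongr; omega
        _ = _ := by ring
    refine ⟨insert u S, lightNeighbors r B m U u \ R, insert_subset (hUA huU) hSA,
      (sdiff_subset.trans (filter_subset _ _)).trans hUA, ?_, ?_, ?_⟩
    · rw [card_insert_of_notMem (hgood u huU).1, hScard]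
    · have h5 : (#(lightNeighbors r B m U u) : ℝ) ≤ #(lightNeighbors r B m U u \ R) + #R := by
        exact_mod_cast card_le_card_sdiff_add_card
      have h6 : (#R : ℝ) ≤ k * m * D := by exact_mod_cast hRcard
      have h7 : Q ^ (i + 1) * #A ≤ Q * #U := by
        rw [pow_succ', mul_assoc]; gcongr
      have h8 : Q ^ k * #A ≤ Q ^ (i + 1) * #A := by
        gcongr ?_ * _; exact pow_le_pow_of_le_one hQ0.le hQ1 hi
      linarith
    · intro v hv
      obtain ⟨hvL, hvR⟩ := mem_sdiff.1 hv
      obtain ⟨hvU, huv, hpos, hlt⟩ := mem_filter.1 hvL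
      refine ⟨by simp [huv.symm, (hgood v hvU).1], ?_⟩
      refine (hgood u huU).2.insert_insert (hgood v hvU).2 hpos hlt fun x hx b hb hxb hub hvb => ?_
      exact hvR (mem_biUnion.2 ⟨x, hx, mem_biUnion.2 ⟨b, mem_filter.2 ⟨hb, hxb, hub⟩,
        mem_filter.2 ⟨hUA hvU, hvb⟩⟩⟩)

end LightCliques

/-! ### Building copies of the subdivision -/

section SubdivisionCopies

open Finset
open scoped Classical

/-- To embed `H_{s,t}` it suffices to give the branch vertices on one side of a bipartition and
the subdivision vertices on the other. -/
theorem subdividedCompleteBipartite_isContained {V : Type*} {G : SimpleGraph V} {s t : ℕ}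
    (X : Set V) (w : Fin s ⊕ Fin t → V) (hw : Function.Injective w) (hwX : ∀ x, w x ∈ X)
    (f : Fin s × Fin t → V) (hf : Function.Injective f) (hfX : ∀ p, f p ∉ X)
    (h : ∀ p, G.Adj (w (Sum.inl p.1)) (f p) ∧ G.Adj (w (Sum.inr p.2)) (f p)) :
    (subdividedCompleteBipartite s t).IsContained G := by
  have hedge : ∀ e : (completeBipartiteGraph (Fin s) (Fin t)).edgeSet,
      ∃ p : Fin s × Fin t, (e : Sym2 (Fin s ⊕ Fin t)) = s(Sum.inl p.1, Sum.inr p.2) := by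
    rintro ⟨e, he⟩
    induction e using Sym2.ind with
    | _ x y =>
      rcases x with i | j <;> rcases y with i' | j' <;>
        simp [completeBipartiteGraph] at he
      · exact ⟨(i, j'), rfl⟩
      · exact ⟨(i', j), Sym2.eq_swap⟩
  choose p hp using hedge
  have hadj : ∀ (e : (completeBipartiteGraph (Fin s) (Fin t)).edgeSet) v, v ∈ (e : Sym2 (Fin s ⊕ Fin t)) → G.Adj (w v) (f (p e)) := by
    intro e v hv
    rw [hp e, Sym2.mem_iff] at hv
    rcases hv with rfl | rfl
    · exact (h _).1
    · exact (h _).2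
  refine ⟨⟨⟨Sum.elim w fun e => f (p e), ?_⟩, ?_⟩⟩
  · rintro (u | e) (v | e') huv
    · exact huv.elim
    · exact hadj e' u huv
    · exact (hadj e v huv).symm
    · exact huv.elim
  · refine hw.sumElim (fun e e' hee => ?_) fun v e hve => ?_
    · have := hf hee
      exact Subtype.ext (by rw [hp e, hp e', this])
    · exact hfX (p e) (hve ▸ hwX v)

/-- Hall's theorem supplies the subdivision vertices, provided that all codegrees among the branch
vertices are large or the branch vertices form a light clique. -/
theorem exists_injective_subdivision_vertices {α β : Type*} (r : α → β → Prop) (B : Finset β)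
    (s t : ℕ) (S : Finset α) (hS : #S = s + t)
    (h : (∀ x ∈ S, ∀ y ∈ S, x ≠ y → s * t ≤ codegree r B x y) ∨ ∃ m, IsLightClique r B m S) :
    ∃ w : Fin s ⊕ Fin t → α, Function.Injective w ∧ (∀ x, w x ∈ S) ∧
      ∃ f : Fin s × Fin t → β, Function.Injective f ∧ (∀ p, f p ∈ B) ∧
        ∀ p, r (w (Sum.inl p.1)) (f p) ∧ r (w (Sum.inr p.2)) (f p) := by
  have e : Fin s ⊕ Fin t ≃ S := Fintype.equivOfCardEq (by simp [hS])
  set w : Fin s ⊕ Fin t → α := fun x => e x with hwdef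
  have hw : Function.Injective w := Subtype.val_injective.comp e.injective
  have hwS : ∀ x, w x ∈ S := fun x => (e x).2
  have hne : ∀ p : Fin s × Fin t, w (Sum.inl p.1) ≠ w (Sum.inr p.2) :=
    fun p => hw.ne Sum.inl_ne_inr
  set T : Fin s × Fin t → Finset β :=
    fun p => {b ∈ B | r (w (Sum.inl p.1)) b ∧ r (w (Sum.inr p.2)) b} with hT
  have hall : ∀ P : Finset (Fin s × Fin t), #P ≤ #(P.biUnion T) := by
    intro P
    rcases P.eq_empty_or_nonempty with rfl | ⟨p, hp⟩
    · simp
    rcases h with h | ⟨m, hm⟩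
    · calc #P ≤ s * t := by simpa using card_le_univ P
        _ ≤ #(T p) := h _ (hwS _) _ (hwS _) (hne p)
        _ ≤ _ := card_le_card (subset_biUnion_of_mem T hp)
    -- Two distinct edges involve at least three branch vertices, so `triple` makes their candidate
    -- sets disjoint.
    · rw [card_biUnion]
      · rw [card_eq_sum_ones]
        exact sum_le_sum fun p _ => hm.pos _ (hwS _) _ (hwS _) (hne p)
      · intro p _ q _ hpq
        rw [Function.onFun, disjoint_left]
        intro b hb hb'
        obtain ⟨hbB, h1, h2⟩ := mem_filter.1 hb
        obtain ⟨-, h3, h4⟩ := mem_filter.1 hb'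
        by_cases h5 : p.1 = q.1
        · have h6 : p.2 ≠ q.2 := fun h6 => hpq (Prod.ext h5 h6)
          exact hm.triple _ (hwS _) _ (hwS _) _ (hwS _) (hne p) (hw.ne Sum.inl_ne_inr)
            (hw.ne fun h => h6 (Sum.inr_injective h)) b hbB h1 h2 h4
        · exact hm.triple _ (hwS _) _ (hwS _) _ (hwS _) (hne p)
            (hw.ne fun h => h5 (Sum.inl_injective h)) (hw.ne Sum.inr_ne_inl) b hbB h1 h2 h3
  obtain ⟨f, hf, hfT⟩ := (all_card_le_biUnion_card_iff_exists_injective T).1 hall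
  exact ⟨w, hw, hwS, f, hf, fun p => (mem_filter.1 (hfT p)).1, fun p => (mem_filter.1 (hfT p)).2⟩

end SubdivisionCopies

/-! ### Trimming to controlled degrees and the density criterion -/

section Extraction

open Finset
open scoped Classical

/-- Up to logarithmic losses, the edges of a graph can be trimmed to a bipartite relation in which
the degrees on both sides are controlled. -/
theorem exists_almost_regular_relation {V : Type*} [Fintype V] (G : SimpleGraph V)
    [DecidableRel G.Adj]
    (hpos : 0 < #G.edgeFinset) :
    ∃ (X A B : Finset V) (r : V → V → Prop) (δ D : ℕ),
      A ⊆ X ∧ Disjoint X B ∧ (∀ a b, r a b → G.Adj a b) ∧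
      (∀ a ∈ A, δ ≤ #{b ∈ B | r a b}) ∧ (∀ b ∈ B, #{a ∈ A | r a b} ≤ D) ∧
      (#G.edgeFinset : ℝ) ≤ 2 * (D * #B * (harmonic (Fintype.card V) : ℝ)) ∧
      (D * #B : ℝ) ≤ δ * #A * (harmonic (Fintype.card V) : ℝ) := by
  obtain ⟨X, -, hX⟩ := exists_cut_of_symmetric (fun a b => if G.Adj a b then 1 else 0)
    (fun a b => by simp only [G.adj_comm]) (fun a => by simp) (univ : Finset V)
  have hedges : ∑ a : V, ∑ b : V, (if G.Adj a b then 1 else 0) = 2 * #G.edgeFinset := by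
    rw [← G.sum_degrees_eq_twice_card_edges]
    refine sum_congr rfl fun a _ => ?_
    rw [← card_filter, ← G.card_neighborFinset_eq_degree]
    congr 1
    ext b
    simp
  rw [hedges, sum_comm] at hX
  simp only [← card_filter] at hX
  obtain ⟨D, hD0, hD⟩ := exists_sum_le_mul_card_filter_mul_harmonic (univ \ X)
    (fun b => #{a ∈ X | G.Adj a b}) (Fintype.card V) (fun b _ => card_le_univ _) (by omega)
  set B : Finset V := {b ∈ univ \ X | D ≤ #{a ∈ X | G.Adj a b}} with hB
  have hE : (#G.edgeFinset : ℝ) ≤ 2 * (D * #B * (harmonic (Fintype.card V) : ℝ)) := by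
    have : (2 * #G.edgeFinset : ℝ) ≤ 4 * (∑ b ∈ univ \ X, #{a ∈ X | G.Adj a b} : ℕ) := by
      exact_mod_cast hX
    linarith
  have hBpos : 0 < #B := by
    rw [Nat.pos_iff_ne_zero]
    intro h0
    rw [h0] at hE
    have : (0 : ℝ) < #G.edgeFinset := by exact_mod_cast hpos
    norm_num only [Nat.cast_zero, mul_zero, zero_mul] at hE
    linarith
  -- Keeping exactly `D` neighbours of each `b ∈ B` caps the degrees while preserving the `D * #B`
  -- edges.
  have hN : ∀ b, ∃ N : Finset V, b ∈ B → N ⊆ {a ∈ X | G.Adj a b} ∧ #N = D := by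
    intro b
    by_cases hb : b ∈ B
    · obtain ⟨N, h1, h2⟩ := exists_subset_card_eq (mem_filter.1 hb).2
      exact ⟨N, fun _ => ⟨h1, h2⟩⟩
    · exact ⟨∅, fun h => absurd h hb⟩
  choose N hN using hN
  obtain ⟨r, hr⟩ : ∃ r : V → V → Prop, ∀ a b, r a b ↔ b ∈ B ∧ a ∈ N b := ⟨_, fun _ _ => Iff.rfl⟩
  have hsum : ∑ a ∈ X, #{b ∈ B | r a b} = D * #B := by
    have := sum_card_bipartiteAbove_eq_sum_card_bipartiteBelow (s := X) (t := B) r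
    simp only [bipartiteAbove, bipartiteBelow] at this
    rw [this, mul_comm, ← smul_eq_mul, ← sum_const]
    refine sum_congr rfl fun b hb => ?_
    rw [← (hN b hb).2]
    congr 1
    ext a
    simp only [mem_filter, hr, hb, true_and, and_iff_right_iff_imp]
    exact fun ha => (mem_filter.1 ((hN b hb).1 ha)).1
  obtain ⟨δ, -, hδ⟩ := exists_sum_le_mul_card_filter_mul_harmonic X
    (fun a => #{b ∈ B | r a b}) (Fintype.card V) (fun b _ => card_le_univ _)
    (by rw [hsum]; positivity)
  refine ⟨X, {a ∈ X | δ ≤ #{b ∈ B | r a b}}, B, r, δ, D, filter_subset _ _, ?_, ?_, ?_, ?_, hE, ?_⟩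
  · rw [disjoint_right]
    intro b hb
    exact (mem_sdiff.1 (mem_filter.1 hb).1).2
  · intro a b hab
    obtain ⟨hb, ha⟩ := (hr a b).1 hab
    exact (mem_filter.1 ((hN b hb).1 ha)).2
  · exact fun a ha => (mem_filter.1 ha).2
  · intro b hb
    rw [← (hN b hb).2]
    exact card_le_card fun a ha => ((hr a b).1 (mem_filter.1 ha).2).2
  · rw [hsum] at hδ
    exact_mod_cast hδ

/-- A graph with sufficiently many edges contains `H_{s,t}`; the parameter `Y` bounds the degrees
of the trimmed relation from below. -/
theorem subdividedCompleteBipartite_isContained_of_le {V : Type*} [Fintype V] (G : SimpleGraph V)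
    [DecidableRel G.Adj]
    {s t k m : ℕ} (hk : 0 < k) (hst : s + t = k + 1) (hm : s * t = m) (hm0 : 0 < m)
    (hpos : 0 < #G.edgeFinset) (H Y : ℝ) (hH1 : 1 ≤ H)
    (hH : (harmonic (Fintype.card V) : ℝ) ≤ H) (hY0 : 0 < Y)
    (hY : 2 * H ^ 2 * Fintype.card V * Y ≤ #G.edgeFinset) (hYH : 2 * k * H ≤ Y)
    (hYQ : 2 * k ^ 2 * m ^ 2 * H ≤ (Y ^ 2 / (4 * Fintype.card V * k * m)) ^ k * Y) :
    (subdividedCompleteBipartite s t).IsContained G := by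
  obtain ⟨X, A, B, r, δ, D, hAX, hXB, hrG, hδ, hD, hE, hE'⟩ := exists_almost_regular_relation G hpos
  have hcopy : ∀ S ⊆ A, #S = s + t →
      ((∀ x ∈ S, ∀ y ∈ S, x ≠ y → s * t ≤ codegree r B x y) ∨ ∃ m, IsLightClique r B m S) →
      (subdividedCompleteBipartite s t).IsContained G := by
    intro S hSA hS h
    obtain ⟨w, hw, hwS, f, hf, hfB, hwf⟩ := exists_injective_subdivision_vertices r B s t S hS h
    exact subdividedCompleteBipartite_isContained X w hw (fun x => hAX (hSA (hwS x))) f hf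
      (fun p hp => disjoint_left.1 hXB hp (hfB p)) fun p => ⟨hrG _ _ (hwf p).1, hrG _ _ (hwf p).2⟩
  by_contra hfree
  have hsmall : ∀ S ⊆ A, #S = k + 1 → ∃ x ∈ S, ∃ y ∈ S, x ≠ y ∧ codegree r B x y < m := by
    intro S hSA hS
    by_contra! hcon
    exact hfree (hcopy S hSA (hS.trans hst.symm) (Or.inl (by rwa [hm])))
  set n : ℝ := (Fintype.card V : ℝ) with hn
  have hEpos : (0 : ℝ) < #G.edgeFinset := by exact_mod_cast hpos
  have hH0 : 0 < H := by linarith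
  have han : (#A : ℝ) ≤ n := Nat.cast_le.2 (card_le_univ A)
  have hbn : (#B : ℝ) ≤ n := Nat.cast_le.2 (card_le_univ B)
  have hE1 : (#G.edgeFinset : ℝ) ≤ 2 * (D * #B * H) := hE.trans (by gcongr)
  have hE2 : (D * #B : ℝ) ≤ δ * #A * H := hE'.trans (by gcongr)
  have hDB : (0 : ℝ) < D * #B := by
    by_contra h
    nlinarith
  have hB0 : 0 < #B := Nat.pos_of_ne_zero fun h => by simp [h] at hDB
  have hδA : (0 : ℝ) < δ * #A := by
    by_contra h
    nlinarith
  have hA0 : 0 < #A := Nat.pos_of_ne_zero fun h => by simp [h] at hδA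
  have hδ0 : 0 < δ := Nat.pos_of_ne_zero fun h => by simp [h] at hδA
  have hBr : (0 : ℝ) < #B := by exact_mod_cast hB0
  have hAr : (0 : ℝ) < #A := by exact_mod_cast hA0
  have hδr : (0 : ℝ) < δ := by exact_mod_cast hδ0
  have hkr : (1 : ℝ) ≤ k := by exact_mod_cast hk
  have hmr : (1 : ℝ) ≤ m := by exact_mod_cast hm0
  have hn0 : 0 < n := hBr.trans_le hbn
  have hYD : Y ≤ D := by
    have h1 : 2 * H ^ 2 * n * Y ≤ 2 * H * n * D := by
      calc _ ≤ 2 * (D * #B * H) := hY.trans hE1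
        _ ≤ 2 * (D * n * H) := by gcongr
        _ = _ := by ring
    have h2 : H * Y ≤ D := by
      refine le_of_mul_le_mul_left ?_ (by positivity : 0 < 2 * H * n)
      linarith
    nlinarith
  have hYδ : Y ≤ δ := by
    refine le_of_mul_le_mul_left ?_ (by positivity : 0 < 2 * H ^ 2 * n)
    calc _ ≤ 2 * (D * #B * H) := hY.trans hE1
      _ ≤ 2 * (δ * #A * H * H) := by gcongr
      _ ≤ 2 * (δ * n * H * H) := by gcongr
      _ = _ := by ring
  -- the density of the light graph forces `B` to be large
  have hBlarge : (δ : ℝ) ^ 2 ≤ 2 * #B * k * m := by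
    have hlarge : 2 * #B * k ≤ δ * #A := by
      have : (2 * #B * k : ℝ) ≤ δ * #A := by
        refine le_of_mul_le_mul_right ?_ hH0
        calc (2 * #B * k * H : ℝ) = #B * (2 * k * H) := by ring
          _ ≤ #B * D := by gcongr; exact hYH.trans hYD
          _ = D * #B := by ring
          _ ≤ _ := hE2
      exact_mod_cast this
    obtain ⟨u, -, hu⟩ := exists_le_card_lightNeighbors r B A k m δ hk (card_pos.1 hA0) hδ hsmall
      hlarge
    have h1 : #(lightNeighbors r B m A u) ≤ #A := card_le_card (filter_subset _ _)
    have h2 : δ ^ 2 * #A ≤ 2 * #B * k * m * #A := hu.trans (by gcongr)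
    exact_mod_cast Nat.le_of_mul_le_mul_right h2 hA0
  -- Half the guaranteed density of light pairs, with `δ` and `#B` replaced by the bounds `Y ≤ δ`
  -- and `#B ≤ n`.
  set Q : ℝ := Y ^ 2 / (4 * n * k * m) with hQdef
  have hQ0 : 0 < Q := by positivity
  have hQ : 4 * #B * k * m * Q ≤ (δ : ℝ) ^ 2 := by
    calc 4 * #B * k * m * Q ≤ 4 * n * k * m * Q := by gcongr
      _ = Y ^ 2 := by rw [hQdef]; field_simp
      _ ≤ _ := by gcongr
  have hQ1 : Q ≤ 1 := by
    have h1 : (0 : ℝ) < 2 * #B * k * m := by positivity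
    by_contra! h
    nlinarith
  have hc : 2 * k * H ≤ 2 * k ^ 2 * m ^ 2 * H := by
    have : (1 : ℝ) ≤ k * m ^ 2 := one_le_mul_of_one_le_of_one_le hkr (one_le_pow₀ hmr)
    calc 2 * k * H = 2 * k * H * 1 := by ring
      _ ≤ 2 * k * H * (k * m ^ 2) := by gcongr
      _ = _ := by ring
  have h1 : 2 * #B * k ≤ δ * (Q ^ k * #A) := by
    refine le_of_mul_le_mul_right ?_ hH0
    calc 2 * #B * k * H = #B * (2 * k * H) := by ring
      _ ≤ #B * (Q ^ k * D) := by
        have : Q ^ k * Y ≤ Q ^ k * D := by gcongr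
        exact mul_le_mul_of_nonneg_left ((hc.trans hYQ).trans this) hBr.le
      _ = Q ^ k * (D * #B) := by ring
      _ ≤ Q ^ k * (δ * #A * H) := by gcongr
      _ = _ := by ring
  have h2 : k * m * D ≤ Q ^ k * #A := by
    -- `hBlarge` turns the edge count `D * #B ≤ δ * #A * H` into an upper bound for `D`.
    have h3 : δ * D ≤ 2 * k * m * H * #A := by
      refine le_of_mul_le_mul_left ?_ hδr
      calc δ * (δ * D : ℝ) = D * δ ^ 2 := by ring
        _ ≤ D * (2 * #B * k * m) := by gcongr
        _ = 2 * k * m * (D * #B) := by ring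
        _ ≤ 2 * k * m * (δ * #A * H) := by gcongr
        _ = _ := by ring
    have h4 : (0 : ℝ) < 2 * k * m * H := by positivity
    refine le_of_mul_le_mul_left ?_ h4
    calc 2 * k * m * H * (k * m * D) = 2 * k ^ 2 * m ^ 2 * H * D := by ring
      _ ≤ Q ^ k * Y * D := by gcongr
      _ ≤ Q ^ k * δ * D := by gcongr
      _ = Q ^ k * (δ * D) := by ring
      _ ≤ Q ^ k * (2 * k * m * H * #A) := by gcongr
      _ = _ := by ring
  obtain ⟨S, U, hSA, hUA, hScard, hUcard, hgood⟩ := exists_isLightClique_insert r A B k m δ D Q hk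
    hm0 hB0 hA0 hδ hD hsmall hQ0 hQ1 hQ h1 h2 k le_rfl
  have hU : 0 < #U := by
    have : (0 : ℝ) < #U := lt_of_lt_of_le (by positivity) hUcard
    exact_mod_cast this
  obtain ⟨v, hv⟩ := card_pos.1 hU
  refine hfree (hcopy (insert v S) (insert_subset (hUA hv) hSA) ?_ (Or.inr ⟨m, (hgood v hv).2⟩))
  rw [card_insert_of_notMem (hgood v hv).1, hScard, hst]

end Extraction

/-! ### Choice of parameters -/

theorem harmonic_le_mul_of_pow_eq {n N : ℕ} {z : ℝ} (hz : 1 ≤ z) (hN : 0 < N)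
    (h : z ^ N = n) : (harmonic n : ℝ) ≤ N * z := by
  have h1 := harmonic_le_one_add_log n
  rw [← h, Real.log_pow] at h1
  have h2 := Real.log_le_sub_one_of_pos (by linarith : 0 < z)
  have h3 : (1 : ℝ) ≤ N := by exact_mod_cast hN
  nlinarith

theorem theorem4p2 (s t : ℕ) (hs : 2 ≤ s) (hst : s ≤ t) :
    ∃ C : ℝ, ∀ n : ℕ,
      (SimpleGraph.extremalNumber n (subdividedCompleteBipartite s t) : ℝ) ≤
        C * (n : ℝ) ^ ((3 : ℝ) / 2 - 1 / (12 * (t : ℝ))) := by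
  classical
  obtain ⟨k, hk⟩ : ∃ k, s + t = k + 1 := ⟨s + t - 1, by omega⟩
  obtain ⟨m, hm⟩ : ∃ m, s * t = m := ⟨_, rfl⟩
  have hk0 : 0 < k := by omega
  have hm0 : 0 < m := hm ▸ Nat.mul_pos (by omega) (by omega)
  have hkr : (1 : ℝ) ≤ k := by exact_mod_cast hk0
  have hmr : (1 : ℝ) ≤ m := by exact_mod_cast hm0
  set c : ℝ := ((48 * t : ℕ) : ℝ) with hc
  have hc1 : 1 ≤ c := by rw [hc]; exact_mod_cast (by omega : 1 ≤ 48 * t)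
  -- Large enough both to absorb `2 * k ^ 2 * m ^ 2 * c` and to make `Q` at least `1 / z ^ 12`.
  set K : ℝ := 4 * k ^ 2 * m ^ 2 * c with hK
  have hK0 : 0 < K := by positivity
  refine ⟨2 * c ^ 2 * K, fun n => ?_⟩
  have hRHS : 0 ≤ 2 * c ^ 2 * K * (n : ℝ) ^ ((3 : ℝ) / 2 - 1 / (12 * (t : ℝ))) := by positivity
  nth_rw 1 [← Fintype.card_fin n]
  rw [SimpleGraph.extremalNumber_le_iff_of_nonneg _ hRHS]
  intro G _ hG
  by_contra! hlt
  have hpos : 0 < G.edgeFinset.card := by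
    have := hRHS.trans_lt hlt
    exact_mod_cast this
  have hn : 0 < n := by
    by_contra h0
    obtain rfl : n = 0 := by omega
    obtain ⟨e, -⟩ := Finset.card_pos.1 hpos
    induction e using Sym2.ind with
    | _ x y => exact x.elim0
  have hnr : (1 : ℝ) ≤ n := by exact_mod_cast hn
  -- With `z = n^(1/(48t))` all exponents are integers, and each harmonic factor costs one power of
  -- `z`.
  obtain ⟨z, hz1, hzn, hzp⟩ : ∃ z : ℝ, 1 ≤ z ∧ z ^ (48 * t) = n ∧
      (n : ℝ) ^ ((3 : ℝ) / 2 - 1 / (12 * (t : ℝ))) = z ^ (72 * t - 4) := by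
    have ht : (t : ℝ) ≠ 0 := by have : t ≠ 0 := by omega
                                exact_mod_cast this
    refine ⟨(n : ℝ) ^ (1 / (48 * t : ℝ)), Real.one_le_rpow hnr (by positivity), ?_, ?_⟩
    · rw [← Real.rpow_natCast, ← Real.rpow_mul (by positivity)]
      push_cast
      rw [one_div_mul_cancel (by positivity), Real.rpow_one]
    · rw [← Real.rpow_natCast, ← Real.rpow_mul (by positivity)]
      congr 1
      rw [Nat.cast_sub (by omega)]
      push_cast
      field_simp
      ring
  rw [hzp] at hlt
  have hz0 : 0 < z := by linarith
  have hharm : (harmonic n : ℝ) ≤ c * z := harmonic_le_mul_of_pow_eq hz1 (by omega) hzn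
  have hHK : 2 * k ^ 2 * m ^ 2 * (c * z) ≤ K * z := by
    rw [hK]
    have : 0 ≤ k ^ 2 * m ^ 2 * (c * z) := by positivity
    linarith
  have hkm : (1 : ℝ) ≤ k * m := one_le_mul_of_one_le_of_one_le hkr hmr
  have hkm2 : (k * m : ℝ) ≤ k ^ 2 * m ^ 2 := by nlinarith
  have hK4 : 4 * k * m ≤ K := by
    calc (4 * k * m : ℝ) = 4 * (k * m) * 1 := by ring
      _ ≤ 4 * (k ^ 2 * m ^ 2) * c := by gcongr
      _ = K := by rw [hK]; ring
  have hK1 : 1 ≤ K := by nlinarith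
  refine hG (subdividedCompleteBipartite_isContained_of_le G hk0 hk hm hm0 hpos (c * z)
    (K * z ^ (24 * t - 6)) (one_le_mul_of_one_le_of_one_le hc1 hz1)
    (by rwa [Fintype.card_fin]) (by positivity) ?_ ?_ ?_)
  · rw [Fintype.card_fin, ← hzn]
    refine le_trans (le_of_eq ?_) hlt.le
    have : 72 * t - 4 = 2 + 48 * t + (24 * t - 6) := by omega
    rw [this, pow_add, pow_add]
    ring
  · have h1 : z ≤ z ^ (24 * t - 6) := le_self_pow₀ hz1 (by omega)
    have h2 : 2 * k * (c * z) ≤ 2 * k ^ 2 * m ^ 2 * (c * z) := by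
      have : (k : ℝ) ≤ k ^ 2 * m ^ 2 := by nlinarith
      have h3 : 0 ≤ c * z := by positivity
      nlinarith
    exact h2.trans (hHK.trans (by gcongr))
  · rw [Fintype.card_fin, ← hzn]
    have h1 : (z ^ (24 * t - 6)) ^ 2 = z ^ (48 * t) / z ^ 12 := by
      rw [eq_div_iff (by positivity), ← pow_mul, ← pow_add]
      congr 1; omega
    have h2 : (K * z ^ (24 * t - 6)) ^ 2 / (4 * z ^ (48 * t) * k * m) =
        K * (K / (4 * k * m)) / z ^ 12 := by
      rw [mul_pow, h1]; field_simp
    have h3 : 1 / z ^ 12 ≤ (K * z ^ (24 * t - 6)) ^ 2 / (4 * z ^ (48 * t) * k * m) := by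
      rw [h2]
      gcongr
      exact one_le_mul_of_one_le_of_one_le hK1 ((one_le_div (by positivity)).2 hK4)
    -- Here `s ≤ t` enters: `k ≤ 2 * t - 1` gives `12 * k + 1 ≤ 24 * t - 6`.
    have h4 : z * z ^ (12 * k) ≤ z ^ (24 * t - 6) := by
      rw [← pow_succ']
      exact pow_le_pow_right₀ hz1 (by omega)
    have h5 : K * z ≤ (1 / z ^ 12) ^ k * (K * z ^ (24 * t - 6)) := by
      rw [one_div, inv_pow, ← pow_mul, ← div_eq_inv_mul, le_div_iff₀ (by positivity), mul_assoc]
      gcongr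
    refine hHK.trans (h5.trans ?_)
    gcongr
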